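/- Let $(A_n)_{n\ge 0}$ be an Appell sequence of real polynomials, i.e. polynomials $A_n\in\mathbb{R}[x]$ with $A_0=1$ and $A_n'=nA_{n-1}$ for all $n\ge 1$. Define its cumulants $c_k$ ($k\ge 1$) by the identity of formal power series \[ \log\Bigl(\sum_{k\ge 0}A_k(0)\frac{t^k}{k!}\Bigr)=\sum_{k\ge 1}c_k\frac{t^k}{k!}. \] For an integer partition $\lambda=(\lambda_1\ge\cdots\ge\lambda_r>0)$ let $|\lambda|=\lambda_1+\cdots+\lambda_r$, let $n_i=\lambda_{r+1-i}+i-1$ for $1\le i\le r$, and let \[ A_\lambda=\frac{\operatorname{Wr}[A_{n_1},\dots,A_{n_r}]}{\prod_{1\le i<j\le r}(n_j-n_i)} \] be the associated Wronskian Appell polynomial, where $\operatorname{Wr}$ is the Wronskian determinant (so $A_\emptyset=1$). Let $F_\lambda$ be the number of standard Young tableaux of shape $\lambda$, i.e. of saturated chains from $\emptyset$ to $\lambda$ in Young's lattice (partitions ordered by inclusion of diagrams). Write $\gamma\gtrdot\lambda$ if $\gamma$ covers $\lambda$ in Young's lattice, i.e. $\lambda<\gamma$ and $|\gamma|=|\lambda|+1$.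 For $k\ge1$, the skew diagram $\gamma/\lambda$ (where $\lambda\le\gamma$) is a rim hook of size $k$ if it is connected (through cells sharing an edge), contains no $2\times 2$ square, and $|\gamma|-|\lambda|=k$; its height $\operatorname{ht}(\gamma/\lambda)$ is one less than the number of rows it occupies. **Theorem 6.2 (top-down relations).** For every partition $\lambda$ (including $\lambda=\emptyset$), the following identities hold in $\mathbb{R}[x]$: \[ (|\lambda|+1)(x+c_1)F_\lambda A_\lambda=\sum_{\gamma\gtrdot\lambda}F_\gamma A_\gamma, \] and, for every integer $k\ge 2$, \[ k\,c_k\binom{|\lambda|+k}{k}F_\lambda A_\lambda=\sum_{\gamma:\ \gamma/\lambda\text{ is a rim hook of size }k}(-1)^{\operatorname{ht}(\gamma/\lambda)}F_\gamma A_\gamma . \] -/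

import Mathlib

noncomputable section

namespace WronskianAppell

open Polynomial

/-! ### Appell sequences and their cumulants -/

/-- Appell sequences of real polynomials: `A 0 = 1` and `(A n)' = n * A (n - 1)` for `1 ≤ n`. -/
structure IsAppell (A : ℕ → ℝ[X]) : Prop where
  zero : A 0 = 1
  deriv : ∀ n : ℕ, derivative (A (n + 1)) = ((n + 1 : ℕ) : ℝ[X]) * A n

/-- The exponential generating function `f_A(t) = ∑ A_k(0) t ^ k / k!` as a formal power series. -/
def momentSeries (A : ℕ → ℝ[X]) : PowerSeries ℝ :=
  PowerSeries.mk fun k => (A k).eval 0 / (k.factorial : ℝ)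

/-- The cumulant `c_k`, defined by `log f_A(t) = ∑ c_k t ^ k / k!`.  (`PowerSeries.logOf f` is the
formal logarithm of a power series `f` with constant term `1`.) -/
def cumulant (A : ℕ → ℝ[X]) (k : ℕ) : ℝ :=
  (k.factorial : ℝ) * PowerSeries.coeff k (PowerSeries.logOf (momentSeries A))

/-! ### Wronskian Appell polynomials -/

/-- The Wronskian of a finite family of polynomials. -/
def wronskianDet {r : ℕ} (f : Fin r → ℝ[X]) : ℝ[X] :=
  (Matrix.of fun i j : Fin r => derivative^[(i : ℕ)] (f j)).det

/-- The length (number of non-zero parts) of a partition given by its diagram. -/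
def length (lam : YoungDiagram) : ℕ := lam.colLen 0

/-- The degree vector `(λ_r, λ_{r-1} + 1, …, λ_1 + r - 1)`, where `r` is the length of the
partition and `lam.rowLen i` is the part `λ_{i+1}`. -/
def degreeVector (lam : YoungDiagram) (i : Fin (length lam)) : ℕ :=
  lam.rowLen (length lam - 1 - (i : ℕ)) + (i : ℕ)

/-- The Vandermonde determinant `det [n_i ^ (j-1)]` of the degree vector. -/
def degreeVandermonde (lam : YoungDiagram) : ℝ :=
  (Matrix.vandermonde fun i => (degreeVector lam i : ℝ)).det

/-- The Vandermonde determinant by which the Wronskian is divided is non-zero. -/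
theorem degreeVandermonde_ne_zero (lam : YoungDiagram) : degreeVandermonde lam ≠ 0 := by
  rw [degreeVandermonde, Matrix.det_vandermonde_ne_zero_iff]
  have h : StrictMono (degreeVector lam) := by
    intro i j hij
    have hij' : (i : ℕ) < j := hij
    have := lam.rowLen_anti (length lam - 1 - (j : ℕ)) (length lam - 1 - (i : ℕ)) (by omega)
    simp only [degreeVector]
    omega
  exact (Nat.cast_injective (R := ℝ)).comp h.injective

/-- The Wronskian Appell polynomial `A_λ = Wr[A_{n_1}, …, A_{n_r}] / Δ(n_1, …, n_r)`. -/
def wap (A : ℕ → ℝ[X]) (lam : YoungDiagram) : ℝ[X] :=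
  C (degreeVandermonde lam)⁻¹ * wronskianDet fun i => A (degreeVector lam i)

/-! ### Young's lattice and standard Young tableaux -/

/-- The diagram `gam` covers `mu` in Young's lattice: `mu < gam` and `|gam| - |mu| = 1`. -/
def Covers (gam mu : YoungDiagram) : Prop := mu < gam ∧ gam.card = mu.card + 1

/-- Standard Young tableaux of shape `lam`, as saturated chains from the empty partition to `lam`
in Young's lattice. -/
def IsStandardTableau (lam : YoungDiagram) (T : Fin (lam.card + 1) → YoungDiagram) : Prop :=
  T 0 = ⊥ ∧ T (Fin.last lam.card) = lam ∧
    ∀ i : Fin lam.card, Covers (T i.succ) (T i.castSucc)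

/-- `F_λ`, the number of standard Young tableaux of shape `lam`. -/
def numTableaux (lam : YoungDiagram) : ℕ :=
  {T : Fin (lam.card + 1) → YoungDiagram | IsStandardTableau lam T}.ncard

/-! ### Rim hooks -/

/-- The grid graph on cells: two cells are adjacent when they share an edge. -/
def cellGraph : SimpleGraph (ℕ × ℕ) where
  Adj c d := (c.1 = d.1 ∧ (c.2 + 1 = d.2 ∨ d.2 + 1 = c.2)) ∨
    (c.2 = d.2 ∧ (c.1 + 1 = d.1 ∨ d.1 + 1 = c.1))
  symm := ⟨fun c d h => by omega⟩
  loopless := ⟨fun c h => by omega⟩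

/-- The skew diagram `gam / mu` (used when `mu ≤ gam`). -/
def skew (gam mu : YoungDiagram) : Finset (ℕ × ℕ) := gam.cells \ mu.cells

/-- `gam / mu` is a rim hook of size `k`: a connected skew diagram without `2 × 2` squares
and with `|gam| - |mu| = k`. -/
structure IsRimHook (k : ℕ) (gam mu : YoungDiagram) : Prop where
  le : mu ≤ gam
  connected : (cellGraph.induce (skew gam mu : Set (ℕ × ℕ))).Connected
  no_square : ∀ i j : ℕ, ¬ ((i, j) ∈ skew gam mu ∧ (i, j + 1) ∈ skew gam mu ∧
    (i + 1, j) ∈ skew gam mu ∧ (i + 1, j + 1) ∈ skew gam mu)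
  size : gam.card = mu.card + k

/-- The height of a rim hook: one less than the number of rows it occupies. -/
def height (gam mu : YoungDiagram) : ℕ := ((skew gam mu).image Prod.fst).card - 1

/-! ### The index sets of the sums -/

theorem finite_card_eq (n : ℕ) : {gam : YoungDiagram | gam.card = n}.Finite := by
  have key : ∀ gam : YoungDiagram, gam.card = n →
      gam.cells ∈ (Finset.range n ×ˢ Finset.range n).powerset := by
    intro gam hg
    rw [Finset.mem_powerset]
    rintro ⟨i, j⟩ hc
    have hc' : (i, j) ∈ gam := hc
    have h1 : j < gam.rowLen i := YoungDiagram.mem_iff_lt_rowLen.1 hc'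
    have h2 : i < gam.colLen j := YoungDiagram.mem_iff_lt_colLen.1 hc'
    have h3 : gam.rowLen i ≤ n := by
      rw [YoungDiagram.rowLen_eq_card, ← hg]
      exact Finset.card_le_card (Finset.filter_subset _ _)
    have h4 : gam.colLen j ≤ n := by
      rw [YoungDiagram.colLen_eq_card, ← hg]
      exact Finset.card_le_card (Finset.filter_subset _ _)
    simp only [Finset.mem_product, Finset.mem_range]
    omega
  refine Set.Finite.of_finite_image (f := YoungDiagram.cells)
    (((Finset.range n ×ˢ Finset.range n).powerset).finite_toSet.subset ?_) ?_
  · rintro _ ⟨gam, hg, rfl⟩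
    exact key gam hg
  · intro a _ b _ h
    exact YoungDiagram.ext h

theorem finite_covers (mu : YoungDiagram) : {gam : YoungDiagram | Covers gam mu}.Finite :=
  (finite_card_eq (mu.card + 1)).subset fun _ h => h.2

theorem finite_rimHook (k : ℕ) (mu : YoungDiagram) :
    {gam : YoungDiagram | IsRimHook k gam mu}.Finite :=
  (finite_card_eq (mu.card + k)).subset fun _ h => h.size

/-- The finite set of all partitions covering `mu`. -/
def coversUp (mu : YoungDiagram) : Finset YoungDiagram := (finite_covers mu).toFinset

/-- The finite set of all `gam` such that `gam / mu` is a rim hook of size `k`. -/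
def rimHooksUp (k : ℕ) (mu : YoungDiagram) : Finset YoungDiagram :=
  (finite_rimHook k mu).toFinset

end WronskianAppell

end

open Polynomial WronskianAppell

noncomputable section

namespace WronskianAppell

open Finset
open scoped PowerSeries

/-! ### Jacobi–Trudi determinants of a power series over a commutative ring. -/

section SchurDeterminant

variable {R : Type*} [CommRing R]

/-! The theorem is the Murnaghan–Nakayama rule under the specialization `h_n = A_n / n!` of
symmetric functions.

Put `H = ∑ A_n t^n / n!`. Since `D^i A_n / n! = A_{n-i} / (n-i)!`, the Wronskian of the `A_{n_j}` is
`∏ n_j!` times the Jacobi–Trudi determinant `s_λ(H)` (`wronskianDet_appell`). The same determinant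
for `exp` is the Vandermonde determinant divided by `∏ n_j!`, and it also equals `F_λ / |λ|!`
(`numTableaux_eq`). All normalizations cancel: `F_λ A_λ = |λ|! s_λ(H)` (`numTableaux_mul_wap`).

The power sums are the coefficients of `H' / H`. As `H = f_A(t) e^{xt}`, they are `p_1 = x + c_1`
and `p_k = c_k / (k-1)!` for `k ≥ 2`. Multiplying `p_k s_λ = ∑ ± s_γ` by `(|λ|+k)!` gives both
identities.

For Murnaghan–Nakayama (`murnaghan_nakayama`), pad `λ` with enough zero rows and sum the
determinants in which one column index is raised by `k`. Evaluated through rows, the sum is `p_k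
s_λ` (`sum_schurDet_update_add`). Evaluated through columns, each term has a repeated index and
vanishes, or is sorted by a cycle into some `γ` with `γ/λ` a rim hook, the sign of the cycle being
the height sign (`sum_rimHooksUp_schur`). -/

theorem sum_det_updateCol_eq_sum_det_updateRow {n : Type*} [Fintype n] [DecidableEq n]
    (M M' : Matrix n n R) :
    ∑ j, (M.updateCol j fun i => M' i j).det = ∑ i, (M.updateRow i (M' i)).det := by
  -- Cramer's rule turns both sides into the trace of `adjugate M * M'`.
  have h1 : ∀ j, (M.updateCol j fun i => M' i j).det = ∑ i, M.adjugate j i * M' i j := by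
    intro j
    rw [← Matrix.cramer_apply, Matrix.cramer_eq_adjugate_mulVec]
    rfl
  have h2 : ∀ i, (M.updateRow i (M' i)).det = ∑ j, M.adjugate j i * M' i j := by
    intro i
    rw [← Matrix.cramer_transpose_apply, Matrix.cramer_eq_adjugate_mulVec,
      ← Matrix.adjugate_transpose]
    rfl
  simp_rw [h1, h2]
  exact sum_comm

/-- The matrix whose rows are the coefficients of `H, X * H, X ^ 2 * H, …` at the positions
`n j`. -/
def shiftMatrix (H : R⟦X⟧) {N : ℕ} (n : Fin N → ℕ) : Matrix (Fin N) (Fin N) R :=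
  Matrix.of fun i j => PowerSeries.coeff (n j) (PowerSeries.X ^ (i : ℕ) * H)

/-- The Jacobi–Trudi determinant whose complete symmetric functions are the coefficients of `H`, indexed
by a strictly increasing degree vector. -/
def schurDet (H : R⟦X⟧) {N : ℕ} (n : Fin N → ℕ) : R := (shiftMatrix H n).det

theorem shiftMatrix_update (H : R⟦X⟧) {N : ℕ} (n : Fin N → ℕ) (q : Fin N) (m : ℕ) :
    shiftMatrix H (Function.update n q m) =
      (shiftMatrix H n).updateCol q fun i => PowerSeries.coeff m (PowerSeries.X ^ (i : ℕ) * H) := by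
  ext i j
  by_cases h : j = q
  · subst h; simp [shiftMatrix]
  · simp [shiftMatrix, h]

theorem schurDet_eq_zero_of_eq (H : R⟦X⟧) {N : ℕ} (n : Fin N → ℕ) {i j : Fin N} (hij : i ≠ j)
    (h : n i = n j) : schurDet H n = 0 :=
  Matrix.det_zero_of_column_eq hij fun a => by simp [shiftMatrix, h]

theorem schurDet_comp_perm (H : R⟦X⟧) {N : ℕ} (n : Fin N → ℕ) (s : Equiv.Perm (Fin N)) :
    schurDet H (n ∘ s) = (Equiv.Perm.sign s : R) * schurDet H n :=
  Matrix.det_permute' s (shiftMatrix H n)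

/-- Pigeonhole: the `i + 1` columns up to `i` are supported in the `i` rows above row `i`, so every
Leibniz term vanishes. -/
theorem det_updateRow_eq_zero_of_forall_lt {N : ℕ} (M : Matrix (Fin N) (Fin N) R) (i : Fin N)
    (v : Fin N → R) (hM : ∀ a j : Fin N, j ≤ i → j < a → M a j = 0) (hv : ∀ j ≤ i, v j = 0) :
    (M.updateRow i v).det = 0 := by
  rw [Matrix.det_apply]
  refine sum_eq_zero fun s _ => ?_
  rw [smul_eq_zero_iff_eq]
  by_contra hne
  have hs : ∀ j ≤ i, s j ∈ Finset.Iio i := by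
    intro j hj
    have h0 : (M.updateRow i v) (s j) j ≠ 0 := fun h0 => hne (prod_eq_zero (mem_univ j) h0)
    rw [Finset.mem_Iio]
    by_contra hlt
    rcases eq_or_ne (s j) i with h | h
    · rw [h, Matrix.updateRow_self] at h0
      exact h0 (hv j hj)
    · rw [Matrix.updateRow_ne h] at h0
      exact h0 (hM _ _ hj (lt_of_le_of_ne (hj.trans (not_lt.1 hlt))
        (fun e => h (le_antisymm (e ▸ hj) (not_lt.1 hlt)))))
  have hc := Finset.card_le_card_of_injOn (s := Finset.Iic i) s
    (fun j hj => hs j (by simpa using hj)) s.injective.injOn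
  simp at hc

theorem coeff_X_pow_mul_of_lt (H : R⟦X⟧) {a m : ℕ} (h : m < a) :
    PowerSeries.coeff m (PowerSeries.X ^ a * H) = 0 := by
  rw [PowerSeries.coeff_X_pow_mul', if_neg (by omega)]

/-- Writing `F = (F * g) * H` expands the new row in the rows `X ^ a * H`, `a < N`, where only `a =
i` contributes. The remaining tail, divisible by `X ^ N`, vanishes in the columns up to `i`, so its
determinant is zero by the pigeonhole lemma. -/
theorem det_updateRow_shiftMatrix (H g : R⟦X⟧) (hg : g * H = 1) {N : ℕ} (n : Fin N → ℕ)
    (i : Fin N) (hn : ∀ j ≤ i, n j = j) (F : R⟦X⟧) :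
    ((shiftMatrix H n).updateRow i fun j => PowerSeries.coeff (n j) F).det =
      PowerSeries.coeff i (F * g) * schurDet H n := by
  obtain ⟨Q, hQ⟩ : ∃ Q : R⟦X⟧,
      F * g = ((PowerSeries.trunc N (F * g) : Polynomial R) : R⟦X⟧) + PowerSeries.X ^ N * Q :=
    ⟨_, by rw [add_comm]; exact (PowerSeries.eq_X_pow_mul_shift_add_trunc N (F * g))⟩
  have hF : F = ∑ a : Fin N, PowerSeries.C (PowerSeries.coeff a (F * g)) *
      (PowerSeries.X ^ (a : ℕ) * H) + PowerSeries.X ^ N * (Q * H) := by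
    have h1 : ((PowerSeries.trunc N (F * g) : Polynomial R) : R⟦X⟧) =
        ∑ a : Fin N, PowerSeries.C (PowerSeries.coeff a (F * g)) * PowerSeries.X ^ (a : ℕ) := by
      ext m
      rw [Polynomial.coeff_coe, PowerSeries.coeff_trunc, map_sum]
      simp only [PowerSeries.coeff_C_mul, PowerSeries.coeff_X_pow, mul_ite, mul_one, mul_zero]
      split_ifs with hm
      · rw [Finset.sum_eq_single ⟨m, hm⟩]
        · simp
        · intro b _ hb
          rw [if_neg]
          rintro rfl
          exact hb rfl
        · simp
      · symm
        refine Finset.sum_eq_zero fun b _ => if_neg ?_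
        have := b.2
        omega
    calc F = (F * g) * H := by rw [mul_assoc, hg, mul_one]
      _ = _ := by
        conv_lhs => rw [hQ, h1]
        rw [add_mul, Finset.sum_mul]
        simp only [mul_assoc]
  have hrow : (fun j => PowerSeries.coeff (n j) F) =
      ∑ a : Fin N, PowerSeries.coeff a (F * g) • shiftMatrix H n a +
        fun j => PowerSeries.coeff (n j) (PowerSeries.X ^ N * (Q * H)) := by
    funext j
    conv_lhs => rw [hF]
    simp [shiftMatrix, Finset.sum_apply, PowerSeries.coeff_C_mul]
  have hN : ∀ j ≤ i, PowerSeries.coeff (n j) (PowerSeries.X ^ N * (Q * H)) = 0 := fun j hj =>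
    coeff_X_pow_mul_of_lt _ (by rw [hn j hj]; exact j.2)
  rw [hrow, Matrix.det_updateRow_add, Matrix.det_updateRow_sum,
    det_updateRow_eq_zero_of_forall_lt _ i _ _ hN, add_zero, smul_eq_mul, schurDet]
  intro a j hj hja
  simp only [shiftMatrix, Matrix.of_apply]
  exact coeff_X_pow_mul_of_lt _ (by rw [hn j hj]; exact hja)

/-- The algebraic form of the Murnaghan–Nakayama rule: the coefficient at `k` of
`H' / H` acts on a Jacobi–Trudi determinant by raising each column index by `k + 1`. -/
theorem sum_schurDet_update_add (H L : R⟦X⟧) (hH : PowerSeries.constantCoeff H = 1)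
    (hL : d⁄dX R H = L * H) {N k : ℕ} (hkN : k + 1 ≤ N) (n : Fin N → ℕ)
    (hn : ∀ j : Fin N, (j : ℕ) < k + 1 → n j = j) :
    ∑ q, schurDet H (Function.update n q (n q + (k + 1))) =
      PowerSeries.coeff k L * schurDet H n := by
  obtain ⟨g, hg⟩ : ∃ g : R⟦X⟧, g * H = 1 :=
    ⟨_, PowerSeries.invOfUnit_mul H 1 (by simpa using hH)⟩
  have e1 : ∑ q, schurDet H (Function.update n q (n q + (k + 1))) =
      ∑ i, ((shiftMatrix H n).updateRow i
        fun j => PowerSeries.coeff (n j + (k + 1)) (PowerSeries.X ^ (i : ℕ) * H)).det := by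
    rw [← sum_det_updateCol_eq_sum_det_updateRow (shiftMatrix H n)
      (fun i j => PowerSeries.coeff (n j + (k + 1)) (PowerSeries.X ^ (i : ℕ) * H))]
    exact Finset.sum_congr rfl fun q _ => by rw [schurDet, shiftMatrix_update]
  have e2 : ∀ i : Fin N, ((shiftMatrix H n).updateRow i
        fun j => PowerSeries.coeff (n j + (k + 1)) (PowerSeries.X ^ (i : ℕ) * H)).det =
      if (i : ℕ) < k + 1 then
        (∑ b ∈ range (i + 1), PowerSeries.coeff (k + 1 - b) H * PowerSeries.coeff b g) *
          schurDet H n else 0 := by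
    intro i
    split_ifs with hi
    · have hF : (fun j => PowerSeries.coeff (n j + (k + 1)) (PowerSeries.X ^ (i : ℕ) * H)) =
          fun j => PowerSeries.coeff (n j)
            (PowerSeries.mk fun m => PowerSeries.coeff (m + (k + 1 - i)) H) := by
        funext j
        rw [PowerSeries.coeff_mk, PowerSeries.coeff_X_pow_mul', if_pos (by omega)]
        congr 1
        congr 1
        omega
      rw [hF, det_updateRow_shiftMatrix H g hg n i
        (fun j hj => hn j (lt_of_le_of_lt (Fin.le_def.1 hj) hi))]
      congr 1
      rw [mul_comm, PowerSeries.coeff_mul, Finset.Nat.sum_antidiagonal_eq_sum_range_succ_mk]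
      refine Finset.sum_congr rfl fun b hb => ?_
      rw [Finset.mem_range] at hb
      rw [PowerSeries.coeff_mk, mul_comm]
      congr 2
      congr 1
      omega
    -- Raising the indices by `k + 1` turns row `i` into row `i - (k + 1)`, so the determinant has
    -- two equal rows.
    · let i' : Fin N := ⟨i - (k + 1), by have := i.2; omega⟩
      have hne : i' ≠ i := fun h => by have := congrArg Fin.val h; simp [i'] at this; omega
      refine Matrix.det_zero_of_row_eq hne ?_
      rw [Matrix.updateRow_ne hne, Matrix.updateRow_self]
      funext j
      simp only [shiftMatrix, Matrix.of_apply, i']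
      rw [PowerSeries.coeff_X_pow_mul', PowerSeries.coeff_X_pow_mul']
      by_cases h : (i : ℕ) - (k + 1) ≤ n j
      · rw [if_pos h, if_pos (by omega)]
        congr 1
        congr 1
        omega
      · rw [if_neg h, if_neg (by omega)]
  rw [e1, Finset.sum_congr rfl fun i _ => e2 i]
  rw [Fin.sum_univ_eq_sum_range (fun i => if i < k + 1 then
        (∑ b ∈ range (i + 1), PowerSeries.coeff (k + 1 - b) H * PowerSeries.coeff b g) *
          schurDet H n else 0) N,
    ← Finset.sum_filter]
  have hf : (range N).filter (· < k + 1) = range (k + 1) := by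
    ext; simp; omega
  rw [hf, ← Finset.sum_mul]
  congr 1
  have hL' : L = g * d⁄dX R H := by rw [hL, mul_comm L H, ← mul_assoc, hg, one_mul]
  rw [hL', PowerSeries.coeff_mul, Finset.Nat.sum_antidiagonal_eq_sum_range_succ_mk]
  have : ∀ i ∈ range (k + 1),
      ∑ b ∈ range (i + 1), PowerSeries.coeff (k + 1 - b) H * PowerSeries.coeff b g =
      ∑ b ∈ range (k + 1), if b ≤ i then
        PowerSeries.coeff (k + 1 - b) H * PowerSeries.coeff b g else 0 := by
    intro i hi
    rw [← Finset.sum_filter]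
    refine Finset.sum_congr ?_ fun _ _ => rfl
    ext b
    simp at hi ⊢
    omega
  rw [Finset.sum_congr rfl this, Finset.sum_comm]
  refine Finset.sum_congr rfl fun b hb => ?_
  rw [Finset.mem_range] at hb
  -- The term `b` occurs for each `i` with `b ≤ i ≤ k`; this multiplicity `k + 1 - b` is the factor
  -- produced by differentiating `H`.
  rw [← Finset.sum_filter, Finset.sum_const, PowerSeries.coeff_derivative]
  have hc : #{i ∈ range (k + 1) | b ≤ i} = k + 1 - b := by
    rw [show {i ∈ range (k + 1) | b ≤ i} = Ico b (k + 1) by ext; simp; omega, Nat.card_Ico]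
  rw [hc, nsmul_eq_mul, show k - b + 1 = k + 1 - b by omega,
    show ((k - b : ℕ) : R) + 1 = ((k + 1 - b : ℕ) : R) by
      rw [show k + 1 - b = k - b + 1 by omega]; push_cast; ring]
  ring

/-- The first column is the first unit vector; this is invariance under appending a zero part. -/
theorem schurDet_succ (H : R⟦X⟧) (hH : PowerSeries.constantCoeff H = 1) {N : ℕ}
    (n : Fin (N + 1) → ℕ)
    (m : Fin N → ℕ) (h0 : n 0 = 0) (hm : ∀ j, n j.succ = m j + 1) :
    schurDet H n = schurDet H m := by
  rw [schurDet, Matrix.det_succ_column_zero, Fin.sum_univ_succ]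
  have h1 : ∀ i : Fin N, shiftMatrix H n i.succ 0 = 0 := fun i => by
    simp only [shiftMatrix, Matrix.of_apply]
    exact coeff_X_pow_mul_of_lt _ (by rw [h0]; simp)
  have h2 : shiftMatrix H n 0 0 = 1 := by simp [shiftMatrix, h0, hH]
  simp only [h1, h2]
  simp only [Fin.val_zero, pow_zero, one_mul, mul_zero, zero_mul, Finset.sum_const_zero, add_zero]
  rw [schurDet]
  congr 1
  ext i j
  simp [shiftMatrix, hm, pow_succ', mul_assoc, PowerSeries.coeff_succ_X_mul]

end SchurDeterminant

/-! ### The exponential specialization and the Vandermonde determinant. -/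

section Exponential

theorem coeff_X_pow_mul_exp (a m : ℕ) :
    PowerSeries.coeff m (PowerSeries.X ^ a * PowerSeries.exp ℝ) * (m.factorial : ℝ) =
      (m.descFactorial a : ℝ) := by
  rw [PowerSeries.coeff_X_pow_mul']
  split_ifs with h
  · rw [PowerSeries.coeff_exp, Nat.descFactorial_eq_div h,
      Nat.cast_div (Nat.factorial_dvd_factorial (Nat.sub_le _ _))
      (by exact_mod_cast Nat.factorial_ne_zero _)]
    simp
    ring
  · rw [Nat.descFactorial_of_lt (by omega)]; simp

/-- Scaling column `j` by `(n j)!` turns its entries into falling factorials of `n j`, which are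
monic of degree `i`. -/
theorem schurDet_exp_mul_prod_factorial {N : ℕ} (n : Fin N → ℕ) :
    schurDet (PowerSeries.exp ℝ) n * ∏ j, ((n j).factorial : ℝ) =
      (Matrix.vandermonde fun j => (n j : ℝ)).det := by
  rw [Matrix.det_eval_matrixOfPolynomials_eq_det_vandermonde _ (fun i => descPochhammer ℝ i)
    (fun i => descPochhammer_natDegree ℝ i) (fun i => monic_descPochhammer ℝ i),
    mul_comm, schurDet, ← Matrix.det_mul_row, ← Matrix.det_transpose]
  congr 1
  ext i j
  simp only [Matrix.transpose_apply, Matrix.of_apply, shiftMatrix]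
  rw [mul_comm, coeff_X_pow_mul_exp, descPochhammer_eval_eq_descFactorial]

/-- Lowering each column index in turn multiplies the exponential determinant by its weight. -/
theorem sum_schurDet_exp_update_sub {N : ℕ} (n : Fin N → ℕ) :
    ∑ q, (if n q = 0 then 0 else schurDet (PowerSeries.exp ℝ) (Function.update n q (n q - 1))) =
      (∑ q, (n q : ℝ) - ∑ i : Fin N, (i : ℝ)) * schurDet (PowerSeries.exp ℝ) n := by
  set M := shiftMatrix (PowerSeries.exp ℝ) n with hM
  -- For `exp`, lowering `n q` multiplies the entry `1 / (n q - i)!` by `n q - i`. The part `n q`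
  -- scales the whole column; the part `i` becomes a row scaling after summation over `q`.
  have key : ∀ q : Fin N, (if n q = 0 then 0 else
      schurDet (PowerSeries.exp ℝ) (Function.update n q (n q - 1))) =
      (n q : ℝ) * M.det - (M.updateCol q fun i => (i : ℝ) * M i q).det := by
    intro q
    have hcol : (M.updateCol q fun i => (n q : ℝ) * M i q - (i : ℝ) * M i q).det =
        (n q : ℝ) * M.det - (M.updateCol q fun i => (i : ℝ) * M i q).det := by
      have := Matrix.det_updateCol_add M q (fun i => (n q : ℝ) * M i q - (i : ℝ) * M i q)
        (fun i => (i : ℝ) * M i q)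
      have h2 := Matrix.det_updateCol_smul M q (n q : ℝ) (fun i => M i q)
      rw [show (M.updateCol q fun i => M i q) = M from Matrix.updateCol_eq_self M q] at h2
      rw [← h2, eq_sub_iff_add_eq, ← this]
      congr 2
      funext i
      simp
    rw [← hcol]
    split_ifs with h0
    · symm
      refine Matrix.det_eq_zero_of_column_eq_zero q fun i => ?_
      rw [Matrix.updateCol_self]
      by_cases hi : (i : ℕ) = 0
      · simp [h0, hi]
      · have : M i q = 0 := coeff_X_pow_mul_of_lt _ (by omega)
        simp [this]
    · rw [schurDet, shiftMatrix_update]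
      congr 2
      funext i
      rw [← sub_mul]
      simp only [hM, shiftMatrix, Matrix.of_apply]
      rw [PowerSeries.coeff_X_pow_mul', PowerSeries.coeff_X_pow_mul']
      rcases lt_trichotomy (n q) i with h | h | h
      · rw [if_neg (by omega), if_neg (by omega)]; simp
      · rw [if_neg (by omega), h]; simp
      · rw [if_pos (by omega), if_pos (by omega), PowerSeries.coeff_exp, PowerSeries.coeff_exp]
        obtain ⟨d, hd⟩ : ∃ d, n q = d + 1 + i := ⟨n q - i - 1, by omega⟩
        rw [show n q - 1 - i = d by omega, show n q - i = d + 1 by omega, hd, Nat.factorial_succ]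
        push_cast
        simp
        field_simp
  rw [Finset.sum_congr rfl fun q _ => key q, Finset.sum_sub_distrib, ← Finset.sum_mul, sub_mul,
    sum_det_updateCol_eq_sum_det_updateRow M (fun i j => (i : ℝ) * M i j)]
  congr 1
  rw [Finset.sum_mul]
  refine Finset.sum_congr rfl fun i _ => ?_
  have := Matrix.det_updateRow_smul M i (i : ℝ) (M i)
  rw [Matrix.updateRow_eq_self] at this
  exact this

end Exponential

/-! ### Young diagrams through their row lengths. -/

section RowLengths

theorem youngDiagram_ext_rowLen {mu nu : YoungDiagram} (h : ∀ i, mu.rowLen i = nu.rowLen i) :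
    mu = nu := by
  ext ⟨i, j⟩
  rw [YoungDiagram.mem_cells, YoungDiagram.mem_cells, YoungDiagram.mem_iff_lt_rowLen,
    YoungDiagram.mem_iff_lt_rowLen, h]

theorem le_iff_rowLen_le {mu nu : YoungDiagram} :
    mu ≤ nu ↔ ∀ i, mu.rowLen i ≤ nu.rowLen i := by
  constructor
  · intro h i
    by_contra! hlt
    exact lt_irrefl _ (YoungDiagram.mem_iff_lt_rowLen.1
      (h (YoungDiagram.mem_iff_lt_rowLen.2 hlt : (i, nu.rowLen i) ∈ mu)))
  · rintro h ⟨i, j⟩ hc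
    exact YoungDiagram.mem_iff_lt_rowLen.2
      ((YoungDiagram.mem_iff_lt_rowLen.1 (hc : (i, j) ∈ mu)).trans_le (h i))

theorem rowLen_eq_zero_of_card_le {mu : YoungDiagram} {i : ℕ} (h : mu.card ≤ i) :
    mu.rowLen i = 0 := by
  by_contra h0
  have h1 : (i, 0) ∈ mu := YoungDiagram.mem_iff_lt_rowLen.2 (Nat.pos_of_ne_zero h0)
  have h2 : i < mu.colLen 0 := YoungDiagram.mem_iff_lt_colLen.1 h1
  have h3 : mu.colLen 0 ≤ mu.card := by
    rw [YoungDiagram.colLen_eq_card]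
    exact Finset.card_le_card (Finset.filter_subset _ _)
  omega

theorem card_eq_sum_rowLen {mu : YoungDiagram} {N : ℕ} (h : ∀ i, N ≤ i → mu.rowLen i = 0) :
    mu.card = ∑ i ∈ range N, mu.rowLen i := by
  have : ∀ c ∈ mu.cells, c.1 ∈ range N := by
    rintro ⟨i, j⟩ hc
    have hc' := YoungDiagram.mem_iff_lt_rowLen.1 (hc : (i, j) ∈ mu)
    by_contra hi
    simp at hi
    rw [h i hi] at hc'
    omega
  rw [YoungDiagram.card, Finset.card_eq_sum_card_fiberwise this]
  exact Finset.sum_congr rfl fun i _ => by rw [YoungDiagram.rowLen_eq_card]; rfl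

theorem card_eq_sum_rowLen_of_card_le {mu : YoungDiagram} {N : ℕ} (h : mu.card ≤ N) :
    mu.card = ∑ i ∈ range N, mu.rowLen i :=
  card_eq_sum_rowLen fun _ hi => rowLen_eq_zero_of_card_le (h.trans hi)

/-- The Young diagram with prescribed row lengths. -/
def diagramOfRows (f : ℕ → ℕ) (hf : Antitone f) (N : ℕ) : YoungDiagram where
  cells := (range N ×ˢ range (f 0)).filter fun c => c.2 < f c.1
  isLowerSet := by
    rintro ⟨i, j⟩ ⟨i', j'⟩ h hc
    obtain ⟨hi : i' ≤ i, hj : j' ≤ j⟩ := h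
    simp only [coe_filter, mem_product, mem_range, Set.mem_ofPred_eq] at hc ⊢
    have := hf hi
    omega

theorem rowLen_diagramOfRows (f : ℕ → ℕ) (hf : Antitone f) (N : ℕ) (hN : ∀ i, N ≤ i → f i = 0)
    (i : ℕ) : (diagramOfRows f hf N).rowLen i = f i := by
  have h : ∀ j, j < (diagramOfRows f hf N).rowLen i ↔ j < f i := by
    intro j
    rw [← YoungDiagram.mem_iff_lt_rowLen, ← YoungDiagram.mem_cells]
    simp only [diagramOfRows, mem_filter, mem_product, mem_range]
    refine ⟨fun h => h.2, fun h => ⟨⟨?_, h.trans_le (hf (Nat.zero_le i))⟩, h⟩⟩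
    by_contra hi
    rw [hN i (by omega)] at h
    omega
  have h1 := h (f i)
  have h2 := h ((diagramOfRows f hf N).rowLen i)
  omega

theorem mem_skew {gam mu : YoungDiagram} {i j : ℕ} :
    (i, j) ∈ skew gam mu ↔ mu.rowLen i ≤ j ∧ j < gam.rowLen i := by
  rw [skew, mem_sdiff, YoungDiagram.mem_cells, YoungDiagram.mem_cells,
    YoungDiagram.mem_iff_lt_rowLen, YoungDiagram.mem_iff_lt_rowLen]
  omega

end RowLengths

/-! ### Rim hooks through row lengths. -/

section RibbonShape

/-- The description by row lengths of a rim hook of size `k` occupying the rows `p, …, q`. -/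
structure IsRibbonShape (k : ℕ) (gam mu : YoungDiagram) (p q : ℕ) : Prop where
  le : p ≤ q
  outside : ∀ i, i < p ∨ q < i → gam.rowLen i = mu.rowLen i
  inside : ∀ i, p ≤ i → i < q → gam.rowLen (i + 1) = mu.rowLen i + 1
  top : gam.rowLen p + q = mu.rowLen q + k + p

/-- A telescoping sum, arranged without subtraction. It makes the size of a rim hook equivalent to
the `top` condition. -/
theorem sum_add_of_interlacing {f g : ℕ → ℕ} {p q N : ℕ} (hpq : p ≤ q) (hq : q < N)
    (hout : ∀ i, i < p ∨ q < i → f i = g i) (hin : ∀ i, p ≤ i → i < q → f (i + 1) = g i + 1) :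
    ∑ i ∈ range N, f i + g q + p = ∑ i ∈ range N, g i + f p + q := by
  have h0 : ∑ i ∈ range p, f i = ∑ i ∈ range p, g i :=
    Finset.sum_congr rfl fun i hi => hout i (Or.inl (by simpa using hi))
  have h1 : ∀ r, p ≤ r → r ≤ q →
      ∑ i ∈ range (r + 1), f i + g r + p = ∑ i ∈ range (r + 1), g i + f p + r := by
    intro r hr
    induction r, hr using Nat.le_induction with
    | base => intro _; rw [sum_range_succ, sum_range_succ]; omega
    | succ r hr ih =>
      intro hrq
      have := ih (by omega)
      have := hin r hr (by omega)
      rw [sum_range_succ, sum_range_succ _ (r + 1)]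
      omega
  induction N, hq using Nat.le_induction with
  | base => exact h1 q hpq le_rfl
  | succ N hN ih =>
    rw [sum_range_succ, sum_range_succ, hout N (Or.inr hN)]
    omega

namespace IsRibbonShape

variable {k : ℕ} {gam mu : YoungDiagram} {p q : ℕ}

theorem rowLen_lt (h : IsRibbonShape k gam mu p q) (hk : 1 ≤ k) {i : ℕ} (hpi : p ≤ i)
    (hiq : i ≤ q) : mu.rowLen i < gam.rowLen i := by
  rcases hpi.eq_or_lt with rfl | hlt
  · rcases h.le.eq_or_lt with rfl | hpq
    · have := h.top
      omega
    · have := h.inside p le_rfl hpq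
      have := gam.rowLen_anti p (p + 1) (by omega)
      omega
  · obtain ⟨j, rfl⟩ : ∃ j, i = j + 1 := ⟨i - 1, by omega⟩
    have := h.inside j (by omega) (by omega)
    have := mu.rowLen_anti j (j + 1) (by omega)
    omega

theorem rowLen_le (h : IsRibbonShape k gam mu p q) (hk : 1 ≤ k) (i : ℕ) :
    mu.rowLen i ≤ gam.rowLen i := by
  by_cases hi : i < p ∨ q < i
  · exact (h.outside i hi).ge
  · exact (h.rowLen_lt hk (by omega) (by omega)).le

theorem card_eq (h : IsRibbonShape k gam mu p q) : gam.card = mu.card + k := by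
  have e := sum_add_of_interlacing (N := gam.card + mu.card + q + 1) h.le (by omega)
    h.outside h.inside
  rw [← card_eq_sum_rowLen_of_card_le (by omega), ← card_eq_sum_rowLen_of_card_le (by omega)] at e
  have := h.top
  omega

theorem mem_skew_rows (h : IsRibbonShape k gam mu p q) {i j : ℕ} (hc : (i, j) ∈ skew gam mu) :
    p ≤ i ∧ i ≤ q := by
  rw [mem_skew] at hc
  by_contra hi
  have := h.outside i (by omega)
  omega

theorem height_eq (h : IsRibbonShape k gam mu p q) (hk : 1 ≤ k) : height gam mu = q - p := by
  have : (skew gam mu).image Prod.fst = Icc p q := by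
    ext i
    simp only [mem_image, Prod.exists, exists_and_right, exists_eq_right, mem_Icc]
    refine ⟨fun ⟨j, hj⟩ => h.mem_skew_rows hj, fun ⟨h1, h2⟩ => ⟨mu.rowLen i, ?_⟩⟩
    exact mem_skew.2 ⟨le_rfl, h.rowLen_lt hk h1 h2⟩
  rw [height, this, Nat.card_Icc]
  omega

/-- The cell below the first cell of row `i` is the last cell of row `i + 1`, so the rows are
chained together. -/
theorem connected (h : IsRibbonShape k gam mu p q) (hk : 1 ≤ k) :
    (cellGraph.induce (skew gam mu : Set (ℕ × ℕ))).Connected := by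
  set G := cellGraph.induce (skew gam mu : Set (ℕ × ℕ)) with hG
  have hstart : ∀ i, p ≤ i → i ≤ q → (i, mu.rowLen i) ∈ skew gam mu := fun i h1 h2 =>
    mem_skew.2 ⟨le_rfl, h.rowLen_lt hk h1 h2⟩
  have hrow : ∀ i d, ∀ h1 : (i, mu.rowLen i) ∈ skew gam mu,
      ∀ h2 : (i, mu.rowLen i + d) ∈ skew gam mu,
      G.Reachable ⟨(i, mu.rowLen i), h1⟩ ⟨(i, mu.rowLen i + d), h2⟩ := by
    intro i d h1
    induction d with
    | zero => exact fun _ => SimpleGraph.Reachable.refl _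
    | succ d ih =>
      intro h2
      have h3 : (i, mu.rowLen i + d) ∈ skew gam mu := by
        rw [mem_skew] at h2 ⊢
        omega
      refine (ih h3).trans (SimpleGraph.Adj.reachable ?_)
      simp only [hG, SimpleGraph.comap_adj, cellGraph]
      exact Or.inl ⟨rfl, Or.inl rfl⟩
  have hdown : ∀ i, ∀ hp : p ≤ i, ∀ hq : i ≤ q,
      G.Reachable ⟨(p, mu.rowLen p), hstart p le_rfl h.le⟩ ⟨(i, mu.rowLen i), hstart i hp hq⟩ := by
    intro i hp
    induction i, hp using Nat.le_induction with
    | base => exact fun _ => SimpleGraph.Reachable.refl _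
    | succ i hp ih =>
      intro hq
      have hlen := h.inside i hp (by omega)
      have hanti := mu.rowLen_anti i (i + 1) (by omega)
      obtain ⟨d, hd⟩ := Nat.exists_eq_add_of_le hanti
      have hmem : (i + 1, mu.rowLen (i + 1) + d) ∈ skew gam mu := by
        rw [mem_skew]
        omega
      refine (ih (by omega)).trans (SimpleGraph.Reachable.trans ?_
        (hrow (i + 1) d (hstart _ (by omega) hq) hmem).symm)
      refine SimpleGraph.Adj.reachable ?_
      simp only [hG, SimpleGraph.comap_adj, cellGraph]
      exact Or.inr ⟨hd, Or.inl rfl⟩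
  rw [SimpleGraph.connected_iff_exists_forall_reachable]
  refine ⟨⟨(p, mu.rowLen p), hstart p le_rfl h.le⟩, ?_⟩
  rintro ⟨⟨i, j⟩, hc⟩
  have hc' : (i, j) ∈ skew gam mu := hc
  obtain ⟨h1, h2⟩ := h.mem_skew_rows hc'
  obtain ⟨d, rfl⟩ := Nat.exists_eq_add_of_le (mem_skew.1 hc').1
  exact (hdown i h1 h2).trans (hrow i d _ hc')

theorem isRimHook (h : IsRibbonShape k gam mu p q) (hk : 1 ≤ k) : IsRimHook k gam mu where
  le := le_iff_rowLen_le.2 (h.rowLen_le hk)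
  connected := h.connected hk
  no_square := by
    rintro i j ⟨h1, -, -, h4⟩
    have r1 := h.mem_skew_rows h1
    have r4 := h.mem_skew_rows h4
    rw [mem_skew] at h1 h4
    have := h.inside i r1.1 (by omega)
    omega
  size := h.card_eq

end IsRibbonShape

/-- Take the first and last occupied rows. The absence of `2 × 2` squares bounds the overlap of
consecutive rows by one column; connectedness forces at least one. -/
theorem IsRimHook.exists_isRibbonShape {k : ℕ} {gam mu : YoungDiagram}
    (h : IsRimHook k gam mu) : ∃ p q, IsRibbonShape k gam mu p q := by
  have hle := le_iff_rowLen_le.1 h.le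
  set S := (skew gam mu).image Prod.fst with hS
  have hmem : ∀ i, i ∈ S ↔ mu.rowLen i < gam.rowLen i := by
    intro i
    simp only [hS, mem_image, Prod.exists, exists_and_right, exists_eq_right]
    refine ⟨fun ⟨j, hj⟩ => ?_, fun hi => ⟨mu.rowLen i, mem_skew.2 ⟨le_rfl, hi⟩⟩⟩
    rw [mem_skew] at hj
    omega
  have hne : S.Nonempty := by
    obtain ⟨⟨c, hc⟩⟩ := h.connected.nonempty
    exact ⟨c.1, mem_image_of_mem _ hc⟩
  set p := S.min' hne
  set q := S.max' hne
  have hp : mu.rowLen p < gam.rowLen p := (hmem p).1 (S.min'_mem hne)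
  have hq : mu.rowLen q < gam.rowLen q := (hmem q).1 (S.max'_mem hne)
  have hpq : p ≤ q := S.min'_le _ (S.max'_mem hne)
  have hout : ∀ i, i < p ∨ q < i → gam.rowLen i = mu.rowLen i := by
    intro i hi
    by_contra hne'
    have hiS : i ∈ S := (hmem i).2 (by have := hle i; omega)
    have := S.min'_le i hiS
    have := S.le_max' i hiS
    omega
  have hin : ∀ i, p ≤ i → i < q → gam.rowLen (i + 1) = mu.rowLen i + 1 := by
    intro i hpi hiq
    refine le_antisymm ?_ ?_
    · by_contra! hlt
      have := mu.rowLen_anti i (i + 1) (by omega)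
      have := gam.rowLen_anti i (i + 1) (by omega)
      exact h.no_square i (mu.rowLen i) (by simp only [mem_skew]; omega)
    · by_contra! hlt
      -- Without a shared column, no edge joins rows `i` and `i + 1`, so no path leads from row `p`
      -- to row `q`.
      have hinv : ∀ c d : (skew gam mu : Set (ℕ × ℕ)),
          (cellGraph.induce (skew gam mu : Set (ℕ × ℕ))).Reachable c d →
          c.1.1 ≤ i → d.1.1 ≤ i := by
        rintro c d ⟨w⟩
        induction w with
        | nil => exact id
        | @cons u v w hadj _ ih =>
          refine fun hu => ih ?_
          obtain ⟨⟨a, b⟩, hab⟩ := u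
          obtain ⟨⟨a', b'⟩, hab'⟩ := v
          have h1 := mem_skew.1 (hab : (a, b) ∈ skew gam mu)
          have h2 := mem_skew.1 (hab' : (a', b') ∈ skew gam mu)
          simp only [SimpleGraph.comap_adj, cellGraph, Function.Embedding.subtype_apply] at hadj hu ⊢
          by_contra hcon
          obtain ⟨rfl, rfl, rfl⟩ : a = i ∧ a' = a + 1 ∧ b' = b := by omega
          omega
      have := hinv ⟨(p, mu.rowLen p), mem_skew.2 ⟨le_rfl, hp⟩⟩
        ⟨(q, mu.rowLen q), mem_skew.2 ⟨le_rfl, hq⟩⟩ (h.connected.preconnected _ _) hpi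
      simp only at this
      omega
  refine ⟨p, q, hpq, hout, hin, ?_⟩
  have e := sum_add_of_interlacing (N := gam.card + mu.card + q + 1) hpq (by omega) hout hin
  rw [← card_eq_sum_rowLen_of_card_le (by omega), ← card_eq_sum_rowLen_of_card_le (by omega)] at e
  have := h.size
  omega

theorem Covers.isRimHook {gam mu : YoungDiagram} (h : Covers gam mu) : IsRimHook 1 gam mu := by
  have hc : (skew gam mu).card = 1 := by
    rw [skew, Finset.card_sdiff_of_subset (YoungDiagram.cells_subset_iff.2 h.1.le)]
    have : gam.cells.card = mu.cells.card + 1 := h.2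
    omega
  obtain ⟨c, hc⟩ := Finset.card_eq_one.1 hc
  refine ⟨h.1.le, ?_, ?_, h.2⟩
  · have : Subsingleton (skew gam mu : Set (ℕ × ℕ)) := by
      rw [hc]; simp
    have : Nonempty (skew gam mu : Set (ℕ × ℕ)) := ⟨⟨c, by simp [hc]⟩⟩
    exact ⟨SimpleGraph.Preconnected.of_subsingleton⟩
  · rintro i j ⟨h1, h2, -⟩
    rw [hc, mem_singleton] at h1 h2
    have := h1.trans h2.symm
    simp at this

theorem covers_iff_isRimHook {gam mu : YoungDiagram} : Covers gam mu ↔ IsRimHook 1 gam mu := by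
  refine ⟨Covers.isRimHook, fun h => ⟨lt_of_le_of_ne h.le ?_, h.size⟩⟩
  rintro rfl
  have := h.size
  omega

theorem IsRibbonShape.eq_of_one {gam mu : YoungDiagram} {p q : ℕ}
    (h : IsRibbonShape 1 gam mu p q) : p = q := by
  by_contra hne
  have hlt : p < q := lt_of_le_of_ne h.le hne
  have := h.inside p le_rfl hlt
  have := gam.rowLen_anti p (p + 1) (by omega)
  have := mu.rowLen_anti p q h.le
  have := h.top
  omega

theorem covers_iff_rowLen {gam mu : YoungDiagram} :
    Covers gam mu ↔ ∃ q, (∀ i, i ≠ q → gam.rowLen i = mu.rowLen i) ∧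
      gam.rowLen q = mu.rowLen q + 1 := by
  constructor
  · intro h
    obtain ⟨p, q, hs⟩ := h.isRimHook.exists_isRibbonShape
    obtain rfl := hs.eq_of_one
    have := hs.top
    exact ⟨p, fun i hi => hs.outside i (by omega), by omega⟩
  · rintro ⟨q, h1, h2⟩
    have hs : IsRibbonShape 1 gam mu q q :=
      ⟨le_rfl, fun i hi => h1 i (by omega), fun i _ _ => by omega, by omega⟩
    exact covers_iff_isRimHook.2 (hs.isRimHook le_rfl)

end RibbonShape

/-! ### Beta numbers: adding a rim hook raises one entry. -/

section BetaNumbers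

/-- The first `N` beta numbers `lam_i + (N - 1 - i)` of a partition, in decreasing order. -/
def betaVec (N : ℕ) (lam : YoungDiagram) (i : Fin N) : ℕ := lam.rowLen i + (N - 1 - i)

theorem betaVec_strictAnti (N : ℕ) (lam : YoungDiagram) : StrictAnti (betaVec N lam) := by
  intro i j hij
  have := lam.rowLen_anti i j (le_of_lt hij)
  have : (i : ℕ) < j := hij
  simp only [betaVec]
  omega

theorem eq_of_betaVec_eq {N : ℕ} {lam mu : YoungDiagram} (hl : lam.card ≤ N) (hm : mu.card ≤ N)
    (h : betaVec N lam = betaVec N mu) : lam = mu := by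
  refine youngDiagram_ext_rowLen fun i => ?_
  by_cases hi : i < N
  · have := congrFun h ⟨i, hi⟩
    simp only [betaVec] at this
    omega
  · rw [rowLen_eq_zero_of_card_le (by omega), rowLen_eq_zero_of_card_le (by omega)]

theorem sum_betaVec {N : ℕ} {lam : YoungDiagram} (h : lam.card ≤ N) :
    ∑ i, betaVec N lam i = lam.card + ∑ i : Fin N, (i : ℕ) := by
  simp only [betaVec]
  rw [Finset.sum_add_distrib, Fin.sum_univ_eq_sum_range (fun i => lam.rowLen i) N,
    ← card_eq_sum_rowLen_of_card_le h, ← Equiv.sum_comp Fin.revPerm fun i : Fin N => (i : ℕ)]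
  congr 1
  refine Finset.sum_congr rfl fun i _ => ?_
  simp [Fin.val_rev]
  omega

/-- The raised entry moves from place `q` to its sorted place `p`, pushing the entries between one
place down. The sign of this cycle is the height sign. -/
theorem IsRibbonShape.betaVec_comp_cycleIcc {k N : ℕ} {gam mu : YoungDiagram} {p q : Fin N}
    (h : IsRibbonShape k gam mu p q) :
    betaVec N gam ∘ Fin.cycleIcc p q =
      Function.update (betaVec N mu) q (betaVec N mu q + k) := by
  have : NeZero N := ⟨by have := p.2; omega⟩
  funext i
  have hi := i.2
  have hq := q.2
  have hp := p.2
  have hpq := h.le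
  rw [Function.comp_apply]
  rcases lt_or_ge i p with h1 | h1
  · have h1' : (i : ℕ) < p := h1
    rw [Fin.cycleIcc_of_lt h1, Function.update_of_ne (fun e => by subst e; omega)]
    simp only [betaVec]
    rw [h.outside i (Or.inl h1)]
  rcases lt_trichotomy i q with h2 | h2 | h2
  · have h2' : (i : ℕ) < q := h2
    rw [Fin.cycleIcc_of_ge_of_lt h1 h2, Function.update_of_ne (ne_of_lt h2)]
    have hv : ((i + 1 : Fin N) : ℕ) = i + 1 := Fin.val_add_one_of_lt' (by omega)
    simp only [betaVec]
    rw [hv, h.inside i h1 h2]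
    omega
  · subst h2
    rw [Fin.cycleIcc_of_last h1, Function.update_self]
    have := h.top
    simp only [betaVec]
    omega
  · rw [Fin.cycleIcc_of_gt h2, Function.update_of_ne (ne_of_gt h2)]
    simp only [betaVec]
    rw [h.outside i (Or.inr h2)]

theorem exists_isRibbonShape {k : ℕ} (hk : 1 ≤ k) (mu : YoungDiagram) {N : ℕ} (q : Fin N)
    (hq : ∀ i, betaVec N mu i ≠ betaVec N mu q + k) :
    ∃ (gam : YoungDiagram) (p : Fin N), IsRibbonShape k gam mu p q := by
  classical
  have hqN := q.2
  -- The inequality says that the raised entry exceeds the beta number at `i`, so the least such `i`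
  -- is its sorted place.
  have hex : ∃ i, mu.rowLen i + q < mu.rowLen q + k + i := ⟨q, by omega⟩
  set p := Nat.find hex with hp
  have hp1 : mu.rowLen p + q < mu.rowLen q + k + p := Nat.find_spec hex
  have hpq : p ≤ q := Nat.find_min' hex (by omega)
  have hlt : ∀ i, i < p → mu.rowLen q + k + i < mu.rowLen i + q := by
    intro i hi
    have h1 := Nat.find_min hex hi
    have h2 := hq ⟨i, by omega⟩
    simp only [betaVec] at h2
    omega
  let f : ℕ → ℕ := fun i => if i < p ∨ (q : ℕ) < i then mu.rowLen i
    else if i = p then mu.rowLen q + k + p - q else mu.rowLen (i - 1) + 1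
  have hf : Antitone f := by
    refine antitone_nat_of_succ_le fun i => ?_
    have a1 := mu.rowLen_anti i (i + 1) (by omega)
    have a2 := mu.rowLen_anti (i - 1) i (by omega)
    have a3 := hlt i
    simp only [f, Nat.add_sub_cancel]
    split_ifs <;> first | omega | (have : i = p := by omega); subst this; omega
  have hN : ∀ i, mu.card + q + 1 ≤ i → f i = 0 := by
    intro i hi
    simp only [f]
    rw [if_pos (by omega), rowLen_eq_zero_of_card_le (by omega)]
  refine ⟨diagramOfRows f hf (mu.card + q + 1), ⟨p, by omega⟩, hpq, ?_, ?_, ?_⟩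
  · intro i hi
    rw [rowLen_diagramOfRows _ _ _ hN]
    exact if_pos hi
  · intro i h1 h2
    simp only at h1
    rw [rowLen_diagramOfRows _ _ _ hN]
    simp only [f]
    rw [if_neg (by omega), if_neg (by omega)]
    simp
  · rw [rowLen_diagramOfRows _ _ _ hN]
    simp only [f]
    rw [if_neg (by omega), if_pos trivial]
    omega

end BetaNumbers

/-! ### The Murnaghan–Nakayama rule for partitions. -/

section SchurSums

variable {R : Type*} [CommRing R]

/-- The Jacobi–Trudi determinant with `N` rows attached to a partition. -/
def schur (H : PowerSeries R) (N : ℕ) (lam : YoungDiagram) : R :=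
  schurDet H (betaVec N lam ∘ Fin.rev)

theorem schur_succ (H : PowerSeries R) (hH : PowerSeries.constantCoeff H = 1) {N : ℕ}
    {lam : YoungDiagram} (h : lam.rowLen N = 0) : schur H (N + 1) lam = schur H N lam := by
  refine schurDet_succ H hH _ _ (by simp [betaVec, h]) fun j => ?_
  have := j.2
  simp only [Function.comp_apply, betaVec, Fin.val_rev, Fin.val_succ]
  rw [show N + 1 - (↑j + 1 + 1) = N - (j + 1) by omega]
  omega

theorem schur_eq_of_le (H : PowerSeries R) (hH : PowerSeries.constantCoeff H = 1) {N N' : ℕ}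
    (hN : N ≤ N') {lam : YoungDiagram} (h : ∀ i, N ≤ i → lam.rowLen i = 0) :
    schur H N' lam = schur H N lam := by
  induction N', hN using Nat.le_induction with
  | base => rfl
  | succ M hM ih => rw [schur_succ H hH (h M hM), ih]

theorem schurDet_comp_perm_rev (H : PowerSeries R) {N : ℕ} (b : Fin N → ℕ)
    (s : Equiv.Perm (Fin N)) :
    schurDet H ((b ∘ s) ∘ Fin.rev) = (Equiv.Perm.sign s : R) * schurDet H (b ∘ Fin.rev) := by
  have h : (b ∘ s) ∘ Fin.rev = (b ∘ Fin.rev) ∘ (Fin.revPerm.symm.permCongr s) := by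
    funext i
    simp
  rw [h, schurDet_comp_perm, Equiv.Perm.sign_permCongr]

theorem schurDet_rev_eq_zero_of_eq (H : PowerSeries R) {N : ℕ} (b : Fin N → ℕ) {i j : Fin N}
    (hij : i ≠ j) (h : b i = b j) : schurDet H (b ∘ Fin.rev) = 0 :=
  schurDet_eq_zero_of_eq H _ (fun e => hij (Fin.rev_injective e)) (by simpa using h)

theorem update_comp_rev {N : ℕ} (b : Fin N → ℕ) (q : Fin N) (m : ℕ) :
    Function.update b q m ∘ Fin.rev = Function.update (b ∘ Fin.rev) q.rev m := by
  funext i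
  by_cases h : i = q.rev
  · subst h; simp
  · have h' : i.rev ≠ q := fun e => h (by rw [← e, Fin.rev_rev])
    simp [h, h']

/-- Rim hooks are matched with their last row `q`; rows that end no rim hook give a repeated beta
number, hence a zero determinant. -/
theorem sum_rimHooksUp_schur (H : PowerSeries R) {k N : ℕ} (hk : 1 ≤ k) (mu : YoungDiagram)
    (hN : mu.card + k ≤ N) :
    ∑ gam ∈ rimHooksUp k mu, (-1) ^ height gam mu * schur H N gam =
      ∑ q, schurDet H
        (Function.update (betaVec N mu) q (betaVec N mu q + k) ∘ Fin.rev) := by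
  have hex : ∀ gam, ∃ q : Fin N, gam ∈ rimHooksUp k mu → ∃ p : Fin N,
      IsRibbonShape k gam mu p q := by
    intro gam
    by_cases hg : gam ∈ rimHooksUp k mu
    · have hr : IsRimHook k gam mu := by simpa [rimHooksUp] using hg
      obtain ⟨p, q, hs⟩ := hr.exists_isRibbonShape
      have hq : q < N := by
        by_contra hcon
        have := hs.rowLen_lt hk hs.le le_rfl
        rw [rowLen_eq_zero_of_card_le (mu := gam) (by have := hr.size; omega)] at this
        omega
      exact ⟨⟨q, hq⟩, fun _ => ⟨⟨p, hs.le.trans_lt hq⟩, hs⟩⟩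
    · exact ⟨⟨0, by omega⟩, fun h => absurd h hg⟩
  choose e he using hex
  refine Finset.sum_of_injOn e ?_ (fun _ _ => mem_coe.2 (mem_univ _)) ?_ ?_
  · intro g1 h1 g2 h2 h12
    obtain ⟨p1, s1⟩ := he g1 h1
    obtain ⟨p2, s2⟩ := he g2 h2
    have b1 := s1.betaVec_comp_cycleIcc
    have b2 := s2.betaVec_comp_cycleIcc
    rw [h12, ← b2] at b1
    -- A strictly decreasing vector is determined by its set of values, so the sorting cycles need
    -- not be compared.
    have hr := congrArg Set.range b1
    rw [EquivLike.range_comp, EquivLike.range_comp,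
      (betaVec_strictAnti N g1).range_inj (betaVec_strictAnti N g2)] at hr
    exact eq_of_betaVec_eq (by have := s1.card_eq; omega) (by have := s2.card_eq; omega) hr
  · intro q _ hq
    by_contra hne
    refine hq ?_
    have hinj : ∀ i, betaVec N mu i ≠ betaVec N mu q + k := by
      intro i hi
      have hiq : i ≠ q := by rintro rfl; omega
      exact hne (schurDet_rev_eq_zero_of_eq H _ hiq (by simp [hiq, hi]))
    obtain ⟨gam, p, hs⟩ := exists_isRibbonShape hk mu q hinj
    have hg : gam ∈ rimHooksUp k mu := by simpa [rimHooksUp] using hs.isRimHook hk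
    refine ⟨gam, mem_coe.2 hg, ?_⟩
    obtain ⟨p', hs'⟩ := he gam hg
    by_contra hneq
    rcases lt_or_gt_of_ne hneq with hlt | hlt
    · have h1 := hs'.outside q (Or.inr hlt)
      have h2 := hs.rowLen_lt hk hs.le le_rfl
      omega
    · have h1 := hs.outside (e gam) (Or.inr hlt)
      have h2 := hs'.rowLen_lt hk hs'.le le_rfl
      omega
  · intro gam hg
    obtain ⟨p, hs⟩ := he gam hg
    rw [← hs.betaVec_comp_cycleIcc, schurDet_comp_perm_rev, Fin.sign_cycleIcc_of_le hs.le,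
      hs.height_eq hk, schur]
    simp

/-- The Murnaghan–Nakayama rule. -/
theorem murnaghan_nakayama (H L : PowerSeries R) (hH : PowerSeries.constantCoeff H = 1)
    (hL : PowerSeries.derivative R H = L * H) (k N : ℕ) (mu : YoungDiagram)
    (hN : mu.card + (k + 1) ≤ N) :
    ∑ gam ∈ rimHooksUp (k + 1) mu, (-1) ^ height gam mu * schur H N gam =
      PowerSeries.coeff k L * schur H N mu := by
  rw [sum_rimHooksUp_schur H (by omega) mu hN, schur,
    ← sum_schurDet_update_add H L hH hL (N := N) (by omega) _ ?_, ← Equiv.sum_comp Fin.revPerm]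
  · refine Finset.sum_congr rfl fun q _ => ?_
    rw [update_comp_rev]
    simp
  -- The bound on `N` leaves the last `k + 1` rows of `mu` empty, so the smallest beta numbers are
  -- `0, …, k`.
  · intro j hj
    have := j.2
    simp only [Function.comp_apply, betaVec, Fin.val_rev]
    rw [rowLen_eq_zero_of_card_le (by omega)]
    omega

end SchurSums

/-! ### Removing a cell, and the branching recursion. -/

section Down

theorem finite_coversDown (lam : YoungDiagram) : {mu : YoungDiagram | Covers lam mu}.Finite :=
  (finite_card_eq (lam.card - 1)).subset fun mu h => by
    have : lam.card = mu.card + 1 := h.2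
    simp only [Set.mem_ofPred_eq]
    omega

/-- The finite set of all partitions covered by `lam`. -/
def coversDown (lam : YoungDiagram) : Finset YoungDiagram := (finite_coversDown lam).toFinset

theorem mem_coversDown {lam mu : YoungDiagram} : mu ∈ coversDown lam ↔ Covers lam mu := by
  simp [coversDown]

theorem betaVec_of_rowLen_succ {N : ℕ} {lam mu : YoungDiagram} {q : Fin N}
    (h1 : ∀ i, i ≠ (q : ℕ) → lam.rowLen i = mu.rowLen i)
    (h2 : lam.rowLen q = mu.rowLen q + 1) :
    betaVec N mu = Function.update (betaVec N lam) q (betaVec N lam q - 1) := by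
  funext i
  by_cases h : i = q
  · subst h
    rw [Function.update_self]
    simp only [betaVec]
    omega
  · rw [Function.update_of_ne h]
    simp only [betaVec]
    rw [h1 i fun e => h (Fin.ext e)]

/-- Lowering a positive beta number either removes a corner or collides with the next one, giving
zero. As `lam.card < N`, the last beta number is `0` and is excluded. -/
theorem sum_coversDown_schur {R : Type*} [CommRing R] (H : PowerSeries R) {N : ℕ}
    (lam : YoungDiagram) (hN : lam.card < N) :
    ∑ mu ∈ coversDown lam, schur H N mu =
      ∑ q, if betaVec N lam q = 0 then 0 else schurDet H
        (Function.update (betaVec N lam) q (betaVec N lam q - 1) ∘ Fin.rev) := by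
  have hex : ∀ mu, ∃ q : Fin N, mu ∈ coversDown lam →
      (∀ i, i ≠ (q : ℕ) → lam.rowLen i = mu.rowLen i) ∧ lam.rowLen q = mu.rowLen q + 1 := by
    intro mu
    by_cases hm : mu ∈ coversDown lam
    · obtain ⟨q, h1, h2⟩ := covers_iff_rowLen.1 (mem_coversDown.1 hm)
      have hq : q < N := by
        by_contra hcon
        rw [rowLen_eq_zero_of_card_le (mu := lam) (by omega)] at h2
        omega
      exact ⟨⟨q, hq⟩, fun _ => ⟨h1, h2⟩⟩
    · exact ⟨⟨0, by omega⟩, fun h => absurd h hm⟩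
  choose e he using hex
  refine Finset.sum_of_injOn e ?_ (fun _ _ => mem_coe.2 (mem_univ _)) ?_ ?_
  · intro m1 h1 m2 h2 h12
    have c1 := (mem_coversDown.1 h1).2
    have c2 := (mem_coversDown.1 h2).2
    refine eq_of_betaVec_eq (N := N) (by omega) (by omega) ?_
    rw [betaVec_of_rowLen_succ (he m1 h1).1 (he m1 h1).2,
      betaVec_of_rowLen_succ (he m2 h2).1 (he m2 h2).2, h12]
  · intro q _ hq
    rw [ite_eq_left_iff]
    intro h0
    by_contra hne
    refine hq ?_
    have hqN := q.2
    have hdesc : lam.rowLen (q + 1) < lam.rowLen q := by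
      by_contra hcon
      have hanti := lam.rowLen_anti q (q + 1) (by omega)
      by_cases hlast : (q : ℕ) + 1 < N
      · have hqq : (⟨q + 1, hlast⟩ : Fin N) ≠ q := fun h => by
          have := congrArg Fin.val h
          simp at this
        refine hne (schurDet_rev_eq_zero_of_eq H _ hqq ?_)
        rw [Function.update_of_ne hqq, Function.update_self]
        simp only [betaVec]
        omega
      · refine h0 ?_
        simp only [betaVec]
        rw [rowLen_eq_zero_of_card_le (by omega)]
        omega
    have hf : Antitone fun i => if i = (q : ℕ) then lam.rowLen q - 1 else lam.rowLen i := by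
      refine antitone_nat_of_succ_le fun i => ?_
      have a1 := lam.rowLen_anti i (i + 1) (by omega)
      split_ifs with c1 c2 c2
      · omega
      · rw [c1] at a1
        omega
      · subst c2
        omega
      · exact a1
    have hrow := rowLen_diagramOfRows _ hf N fun i hi => by
      rw [if_neg (by omega), rowLen_eq_zero_of_card_le (by omega)]
    set mu := diagramOfRows _ hf N
    have h1 : ∀ i, i ≠ (q : ℕ) → lam.rowLen i = mu.rowLen i := fun i hi => by
      rw [hrow, if_neg hi]
    have h2 : lam.rowLen q = mu.rowLen q + 1 := by
      rw [hrow, if_pos rfl]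
      omega
    have hmu : mu ∈ coversDown lam := mem_coversDown.2 (covers_iff_rowLen.2 ⟨q, h1, h2⟩)
    refine ⟨mu, mem_coe.2 hmu, ?_⟩
    by_contra hne'
    have := (he mu hmu).1 q fun h => hne' (Fin.ext h.symm)
    omega
  · intro mu hm
    obtain ⟨h1, h2⟩ := he mu hm
    rw [if_neg (by simp only [betaVec]; omega), ← betaVec_of_rowLen_succ h1 h2, schur]

theorem sum_coversDown_schur_exp {N : ℕ} (lam : YoungDiagram) (hN : lam.card < N) :
    ∑ mu ∈ coversDown lam, schur (PowerSeries.exp ℝ) N mu =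
      lam.card * schur (PowerSeries.exp ℝ) N lam := by
  have h := sum_schurDet_exp_update_sub (betaVec N lam ∘ Fin.rev)
  have hs : ∑ q, ((betaVec N lam ∘ Fin.rev) q : ℝ) - ∑ i : Fin N, ((i : ℕ) : ℝ) = lam.card := by
    have := sum_betaVec hN.le
    rw [← Equiv.sum_comp Fin.revPerm] at this
    simp only [Fin.revPerm_apply] at this
    simp only [Function.comp_apply]
    rw [sub_eq_iff_eq_add]
    exact_mod_cast this
  rw [hs] at h
  rw [sum_coversDown_schur _ lam hN, schur, ← h, ← Equiv.sum_comp Fin.revPerm]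
  refine Finset.sum_congr rfl fun q _ => ?_
  rw [update_comp_rev]
  simp

end Down

/-! ### Counting standard Young tableaux. -/

section Tableaux

/-- The saturated chains of length `n` from the empty partition to `lam`. -/
def chains (n : ℕ) (lam : YoungDiagram) : Set (Fin (n + 1) → YoungDiagram) :=
  {T | T 0 = ⊥ ∧ T (Fin.last n) = lam ∧ ∀ i : Fin n, Covers (T i.succ) (T i.castSucc)}

theorem chains_succ (n : ℕ) (lam : YoungDiagram) :
    chains (n + 1) lam = ⋃ mu ∈ coversDown lam,
      (fun T : Fin (n + 1) → YoungDiagram => (Fin.snoc T lam : Fin (n + 2) → YoungDiagram)) ''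
        chains n mu := by
  ext T
  simp only [Set.mem_iUnion, Set.mem_image, mem_coversDown, exists_prop]
  constructor
  · rintro ⟨h0, h1, h2⟩
    refine ⟨T (Fin.last n).castSucc, ?_, Fin.init T, ⟨h0, rfl, fun i => h2 i.castSucc⟩, ?_⟩
    · have := h2 (Fin.last n)
      rwa [Fin.succ_last, h1] at this
    · rw [← h1]
      exact Fin.snoc_init_self T
  · rintro ⟨mu, hmu, T, ⟨h0, h1, h2⟩, rfl⟩
    refine ⟨?_, Fin.snoc_last _ _, fun i => ?_⟩
    · rw [← Fin.castSucc_zero, Fin.snoc_castSucc, h0]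
    · induction i using Fin.lastCases with
      | last =>
        rw [Fin.succ_last, Fin.snoc_last, Fin.snoc_castSucc, h1]
        exact hmu
      | cast i =>
        rw [Fin.succ_castSucc, Fin.snoc_castSucc, Fin.snoc_castSucc]
        exact h2 i

theorem snoc_right_injective (n : ℕ) (lam : YoungDiagram) : Function.Injective
    (fun T : Fin (n + 1) → YoungDiagram => (Fin.snoc T lam : Fin (n + 2) → YoungDiagram)) := by
  intro T T' h
  have := congrArg Fin.init h
  simpa using this

theorem finite_chains (n : ℕ) (lam : YoungDiagram) : (chains n lam).Finite := by
  induction n generalizing lam with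
  | zero =>
    refine (Set.finite_singleton fun _ => ⊥).subset ?_
    rintro T ⟨h0, -⟩
    funext i
    obtain rfl : i = 0 := Fin.eq_zero i
    exact h0
  | succ n ih =>
    rw [chains_succ]
    exact (coversDown lam).finite_toSet.biUnion fun mu _ => (ih mu).image _

theorem ncard_chains_succ (n : ℕ) (lam : YoungDiagram) :
    (chains (n + 1) lam).ncard = ∑ mu ∈ coversDown lam, (chains n mu).ncard := by
  classical
  have h : (chains (n + 1) lam) = ((coversDown lam).biUnion fun mu =>
      (finite_chains n mu).toFinset.image fun T : Fin (n + 1) → YoungDiagram =>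
        (Fin.snoc T lam : Fin (n + 2) → YoungDiagram) :
          Finset (Fin (n + 2) → YoungDiagram)) := by
    rw [chains_succ]
    simp
  rw [h, Set.ncard_coe_finset, Finset.card_biUnion]
  · refine Finset.sum_congr rfl fun mu _ => ?_
    rw [Finset.card_image_of_injective _ (snoc_right_injective n lam),
      ← Set.ncard_eq_toFinset_card _ (finite_chains n mu)]
  · intro m1 _ m2 _ hne
    rw [Function.onFun, Finset.disjoint_left]
    intro T h1 h2
    simp only [mem_image, Set.Finite.mem_toFinset] at h1 h2
    obtain ⟨T1, c1, rfl⟩ := h1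
    obtain ⟨T2, c2, e⟩ := h2
    obtain rfl := snoc_right_injective n lam e
    exact hne (c1.2.1.symm.trans c2.2.1)

theorem numTableaux_eq_ncard_chains (lam : YoungDiagram) :
    numTableaux lam = (chains lam.card lam).ncard := rfl

theorem schur_bot {R : Type*} [CommRing R] (H : PowerSeries R)
    (hH : PowerSeries.constantCoeff H = 1) (N : ℕ) : schur H N ⊥ = 1 := by
  rw [schur_eq_of_le H hH (Nat.zero_le N)
    fun i _ => rowLen_eq_zero_of_card_le (by simp [YoungDiagram.card])]
  simp [schur, schurDet]

/-- Deleting the last step of a chain gives `F_λ = ∑ F_μ` over the `μ` covered by `λ`;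
`sum_coversDown_schur_exp` is the matching recursion for the determinant. -/
theorem numTableaux_eq (lam : YoungDiagram) {N : ℕ} (hN : lam.card < N) :
    (numTableaux lam : ℝ) = lam.card.factorial * schur (PowerSeries.exp ℝ) N lam := by
  rw [numTableaux_eq_ncard_chains]
  induction hn : lam.card generalizing lam with
  | zero =>
    have hbot : lam = ⊥ := by
      ext c
      rw [Finset.card_eq_zero.1 (hn : lam.cells.card = 0)]
      rfl
    subst hbot
    have : chains 0 ⊥ = {fun _ => ⊥} := by
      ext T
      refine ⟨fun h => ?_, ?_⟩
      · funext i
        obtain rfl : i = 0 := Fin.eq_zero i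
        exact h.1
      · rintro rfl
        exact ⟨rfl, rfl, fun i => i.elim0⟩
    rw [this, schur_bot _ (by simp)]
    simp
  | succ n ih =>
    rw [ncard_chains_succ, Nat.cast_sum]
    have h : ∀ mu ∈ coversDown lam, ((chains n mu).ncard : ℝ) =
        n.factorial * schur (PowerSeries.exp ℝ) N mu := by
      intro mu hmu
      have : lam.card = mu.card + 1 := (mem_coversDown.1 hmu).2
      exact ih mu (by omega) (by omega)
    rw [Finset.sum_congr rfl h, ← Finset.mul_sum, sum_coversDown_schur_exp lam hN, hn,
      Nat.factorial_succ]
    push_cast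
    ring

end Tableaux

/-! ### The logarithmic derivative. -/

section Logarithm

/-- Substitute `f - 1` into `log' * (1 + X) = 1` and apply the chain rule. -/
theorem derivative_logOf_mul {f : PowerSeries ℝ} (hf : PowerSeries.constantCoeff f = 1) :
    PowerSeries.derivative ℝ (PowerSeries.logOf f) * f = PowerSeries.derivative ℝ f := by
  have hs : PowerSeries.HasSubst (f - 1) :=
    PowerSeries.HasSubst.of_constantCoeff_zero' (by simp [hf])
  have h1 : PowerSeries.derivative ℝ (PowerSeries.log ℝ) * (1 + PowerSeries.X) = 1 := by
    ext n
    rw [PowerSeries.deriv_log, mul_add, mul_one, map_add, PowerSeries.coeff_mk]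
    cases n with
    | zero => simp
    | succ n =>
      rw [PowerSeries.coeff_succ_mul_X, PowerSeries.coeff_mk, PowerSeries.coeff_one,
        if_neg (Nat.succ_ne_zero n)]
      simp [pow_succ]
  have h2 := congrArg (PowerSeries.subst (f - 1)) h1
  rw [← PowerSeries.coe_substAlgHom hs, map_mul, map_add, map_one,
    PowerSeries.coe_substAlgHom hs, PowerSeries.subst_X hs, add_sub_cancel] at h2
  rw [PowerSeries.logOf_eq, PowerSeries.derivative_subst hs, mul_right_comm, h2, one_mul]
  simp

end Logarithm

/-! ### Appell sequences as a specialization of Jacobi–Trudi determinants. -/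

section Appell

variable {A : ℕ → ℝ[X]}

/-- The exponential generating function of a sequence of polynomials. -/
def appellSeries (A : ℕ → ℝ[X]) : PowerSeries ℝ[X] :=
  PowerSeries.mk fun n => C ((n.factorial : ℝ)⁻¹) * A n

theorem constantCoeff_appellSeries (hA : IsAppell A) :
    PowerSeries.constantCoeff (appellSeries A) = 1 := by
  rw [← PowerSeries.coeff_zero_eq_constantCoeff_apply]
  simp [appellSeries, hA.zero]

theorem constantCoeff_momentSeries (hA : IsAppell A) :
    PowerSeries.constantCoeff (momentSeries A) = 1 := by
  rw [← PowerSeries.coeff_zero_eq_constantCoeff_apply]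
  simp [momentSeries, hA.zero]

theorem eq_of_derivative_eq_of_eval_zero_eq {p q : ℝ[X]} (h : derivative p = derivative q)
    (h0 : p.eval 0 = q.eval 0) : p = q := by
  have hd : derivative (p - q) = 0 := by rw [derivative_sub, h, sub_self]
  have hc := derivative_eq_zero.1 hd
  rw [← sub_eq_zero, eq_C_of_natDegree_eq_zero hc, coeff_zero_eq_eval_zero, eval_sub, h0, sub_self,
    C_0]

/-- The formal power series `exp (x t)` in `t` with coefficients in `ℝ[x]`. -/
def expX : PowerSeries ℝ[X] := PowerSeries.mk fun n => C ((n.factorial : ℝ)⁻¹) * X ^ n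

theorem derivative_expX : PowerSeries.derivative ℝ[X] expX = PowerSeries.C X * expX := by
  ext1 n
  rw [PowerSeries.coeff_derivative, PowerSeries.coeff_C_mul, expX, PowerSeries.coeff_mk,
    PowerSeries.coeff_mk]
  have : C (((n + 1).factorial : ℝ)⁻¹) * ((n : ℝ[X]) + 1) = C ((n.factorial : ℝ)⁻¹) := by
    rw [show ((n : ℝ[X]) + 1) = C ((n : ℝ) + 1) by simp, ← C_mul, Nat.factorial_succ]
    congr 1
    push_cast
    field_simp
  rw [← this, pow_succ]
  ring

theorem derivative_C_inv_factorial_mul {B : ℕ → ℝ[X]}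
    (hB : ∀ n : ℕ, derivative (B (n + 1)) = ((n + 1 : ℕ) : ℝ[X]) * B n) (n : ℕ) :
    derivative (C (((n + 1).factorial : ℝ)⁻¹) * B (n + 1)) = C ((n.factorial : ℝ)⁻¹) * B n := by
  rw [derivative_C_mul, hB, ← mul_assoc, ← C_eq_natCast, ← C_mul, Nat.factorial_succ]
  congr 2
  push_cast
  field_simp

/-- On both sides the `x`-derivative of each coefficient is the preceding coefficient, and the
values at `x = 0` agree. -/
theorem appellSeries_eq (hA : IsAppell A) :
    appellSeries A = PowerSeries.map C (momentSeries A) * expX := by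
  ext1 n
  have hc : ∀ n, PowerSeries.coeff n (PowerSeries.map C (momentSeries A) * expX) =
      ∑ i ∈ range (n + 1), C (PowerSeries.coeff (n - i) (momentSeries A)) *
        (C ((i.factorial : ℝ)⁻¹) * X ^ i) := by
    intro n
    rw [mul_comm, PowerSeries.coeff_mul, Finset.Nat.sum_antidiagonal_eq_sum_range_succ_mk]
    refine Finset.sum_congr rfl fun i _ => ?_
    rw [PowerSeries.coeff_map, expX, PowerSeries.coeff_mk, mul_comm]
  induction n with
  | zero => rw [hc]; simp [appellSeries, momentSeries, hA.zero]
  | succ n ih =>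
    refine eq_of_derivative_eq_of_eval_zero_eq ?_ ?_
    · rw [appellSeries, PowerSeries.coeff_mk] at ih ⊢
      rw [derivative_C_inv_factorial_mul hA.deriv, ih, hc (n + 1), sum_range_succ', derivative_add,
        derivative_sum, pow_zero, mul_one, ← C_mul, derivative_C, add_zero, hc n]
      refine Finset.sum_congr rfl fun i _ => ?_
      rw [derivative_C_mul, derivative_C_inv_factorial_mul
        (B := fun i => X ^ i) (fun m => by simp), Nat.add_sub_add_right]
    · rw [hc, eval_finsetSum, sum_range_succ', Finset.sum_eq_zero fun i _ => by simp]
      simp [appellSeries, momentSeries, div_eq_inv_mul]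

/-- The logarithmic derivative of `appellSeries A`. -/
def powerSumSeries (A : ℕ → ℝ[X]) : PowerSeries ℝ[X] :=
  PowerSeries.C X +
    PowerSeries.map C (PowerSeries.derivative ℝ (PowerSeries.logOf (momentSeries A)))

theorem derivative_map_C (f : PowerSeries ℝ) :
    PowerSeries.derivative ℝ[X] (PowerSeries.map C f) =
      PowerSeries.map C (PowerSeries.derivative ℝ f) := by
  ext1 n
  simp [PowerSeries.coeff_derivative]

theorem derivative_mul_powerSeries {R : Type*} [CommRing R] (f g : PowerSeries R) :
    PowerSeries.derivative R (f * g) =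
      f * PowerSeries.derivative R g + PowerSeries.derivative R f * g := by
  rw [Derivation.leibniz, smul_eq_mul, smul_eq_mul, mul_comm g]

theorem derivative_appellSeries (hA : IsAppell A) :
    PowerSeries.derivative ℝ[X] (appellSeries A) = powerSumSeries A * appellSeries A := by
  rw [appellSeries_eq hA, derivative_mul_powerSeries, derivative_map_C, derivative_expX,
    ← derivative_logOf_mul (constantCoeff_momentSeries hA), map_mul, powerSumSeries]
  ring

theorem coeff_powerSumSeries_zero :
    PowerSeries.coeff 0 (powerSumSeries A) = X + C (cumulant A 1) := by
  rw [powerSumSeries, map_add, PowerSeries.coeff_zero_C, PowerSeries.coeff_map,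
    PowerSeries.coeff_derivative, cumulant]
  simp

theorem factorial_mul_coeff_powerSumSeries {k : ℕ} (hk : 1 ≤ k) :
    C ((k + 1).factorial : ℝ) * PowerSeries.coeff k (powerSumSeries A) =
      ((k + 1 : ℕ) : ℝ[X]) * C (cumulant A (k + 1)) := by
  rw [powerSumSeries, map_add, PowerSeries.coeff_C, if_neg (by omega), zero_add,
    PowerSeries.coeff_map, PowerSeries.coeff_derivative, cumulant, ← C_eq_natCast, ← C_mul,
    ← C_mul]
  congr 1
  push_cast
  ring

theorem iterate_derivative_appell (hA : IsAppell A) (i n : ℕ) :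
    derivative^[i] (A n) = C (n.factorial : ℝ) *
      PowerSeries.coeff n (PowerSeries.X ^ i * appellSeries A) := by
  have h : ∀ n i, i ≤ n → derivative^[i] (A n) =
      C ((n.factorial : ℝ) * ((n - i).factorial : ℝ)⁻¹) * A (n - i) := by
    intro n i
    induction i with
    | zero => intro _; simp [Nat.factorial_ne_zero]
    | succ i ih =>
      intro hi
      obtain ⟨d, rfl⟩ : ∃ d, n = d + 1 + i := ⟨n - i - 1, by omega⟩
      rw [Function.iterate_succ_apply', ih (by omega), Nat.add_sub_cancel,
        show d + 1 + i - (i + 1) = d by omega, C_mul, mul_assoc, derivative_C_mul,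
        derivative_C_inv_factorial_mul hA.deriv, C_mul, mul_assoc]
  rw [PowerSeries.coeff_X_pow_mul']
  split_ifs with hi
  · rw [h n i hi, appellSeries, PowerSeries.coeff_mk, C_mul, mul_assoc]
  · obtain ⟨d, rfl⟩ : ∃ d, i = d + 1 + n := ⟨i - n - 1, by omega⟩
    rw [Function.iterate_add_apply, h n n le_rfl, Nat.sub_self, hA.zero, mul_one, mul_zero,
      Function.iterate_succ_apply, derivative_C, iterate_derivative_zero]

theorem wronskianDet_appell (hA : IsAppell A) {r : ℕ} (n : Fin r → ℕ) :
    wronskianDet (fun j => A (n j)) =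
      (∏ j, C ((n j).factorial : ℝ)) * schurDet (appellSeries A) n := by
  rw [wronskianDet, schurDet, ← Matrix.det_mul_row]
  congr 1
  ext1 i j
  simp only [Matrix.of_apply, shiftMatrix]
  exact iterate_derivative_appell hA _ _

theorem degreeVector_eq (lam : YoungDiagram) :
    degreeVector lam = betaVec (length lam) lam ∘ Fin.rev := by
  funext i
  have := i.2
  simp only [degreeVector, betaVec, Function.comp_apply, Fin.val_rev]
  rw [show length lam - 1 - (i : ℕ) = length lam - (i + 1) by omega]
  omega

theorem rowLen_eq_zero_of_length_le {lam : YoungDiagram} {i : ℕ} (h : length lam ≤ i) :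
    lam.rowLen i = 0 := by
  by_contra h0
  have h1 : (i, 0) ∈ lam := YoungDiagram.mem_iff_lt_rowLen.2 (Nat.pos_of_ne_zero h0)
  have h2 : i < lam.colLen 0 := YoungDiagram.mem_iff_lt_colLen.1 h1
  rw [length] at h
  omega

theorem length_le_card (lam : YoungDiagram) : length lam ≤ lam.card := by
  rw [length, YoungDiagram.colLen_eq_card]
  exact Finset.card_le_card (Finset.filter_subset _ _)

/-- The Vandermonde determinant and the factorials `n_j!` in `wap` cancel against those in the `exp`
formula for `F_λ`. -/
theorem numTableaux_mul_wap (hA : IsAppell A) (lam : YoungDiagram) {N : ℕ} (hN : lam.card < N) :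
    (numTableaux lam : ℝ[X]) * wap A lam =
      C (lam.card.factorial : ℝ) * schur (appellSeries A) N lam := by
  have hlen : length lam ≤ N := (length_le_card lam).trans hN.le
  have hz : ∀ i, length lam ≤ i → lam.rowLen i = 0 := fun i hi => rowLen_eq_zero_of_length_le hi
  have hF : (numTableaux lam : ℝ) * (degreeVandermonde lam)⁻¹ *
      ∏ j, ((degreeVector lam j).factorial : ℝ) = lam.card.factorial := by
    have h1 : schur (PowerSeries.exp ℝ) N lam * ∏ j, ((degreeVector lam j).factorial : ℝ) =
        degreeVandermonde lam := by
      rw [schur_eq_of_le _ (by simp) hlen hz, schur, ← degreeVector_eq,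
        schurDet_exp_mul_prod_factorial, degreeVandermonde]
    rw [numTableaux_eq lam hN, mul_right_comm, mul_assoc (lam.card.factorial : ℝ), h1,
      mul_assoc, mul_inv_cancel₀ (degreeVandermonde_ne_zero lam), mul_one]
  rw [wap, wronskianDet_appell hA, schur_eq_of_le _ (constantCoeff_appellSeries hA) hlen hz, schur,
    ← degreeVector_eq, ← hF, ← C_eq_natCast, C_mul, C_mul, map_prod]
  ring

theorem sum_rimHooksUp_wap (hA : IsAppell A) (k : ℕ) (lam : YoungDiagram) :
    ∑ gam ∈ rimHooksUp (k + 1) lam,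
        (-1) ^ height gam lam * (numTableaux gam : ℝ[X]) * wap A gam =
      ((lam.card + (k + 1)).choose (k + 1) : ℝ[X]) *
        (C ((k + 1).factorial : ℝ) * PowerSeries.coeff k (powerSumSeries A)) *
          ((numTableaux lam : ℝ[X]) * wap A lam) := by
  have hN : lam.card + (k + 1) < lam.card + (k + 1) + 1 := Nat.lt_succ_self _
  have h : ∀ gam ∈ rimHooksUp (k + 1) lam,
      (-1) ^ height gam lam * (numTableaux gam : ℝ[X]) * wap A gam =
        C ((lam.card + (k + 1)).factorial : ℝ) * ((-1) ^ height gam lam *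
          schur (appellSeries A) (lam.card + (k + 1) + 1) gam) := by
    intro gam hg
    have hr : IsRimHook (k + 1) gam lam := by simpa [rimHooksUp] using hg
    rw [mul_assoc, numTableaux_mul_wap hA gam (hr.size.trans_lt hN), hr.size]
    ring
  -- All `gam` have the same size, so one factorial leaves the sum; it splits as binomial
  -- coefficient times `|λ|!` times `(k + 1)!`.
  rw [Finset.sum_congr rfl h, ← Finset.mul_sum,
    murnaghan_nakayama _ _ (constantCoeff_appellSeries hA) (derivative_appellSeries hA) _ _ _
      hN.le, numTableaux_mul_wap hA lam (N := lam.card + (k + 1) + 1) (by omega),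
    ← Nat.add_choose_mul_factorial_mul_factorial]
  push_cast
  simp only [C_mul, C_eq_natCast]
  ring

theorem coversUp_eq_rimHooksUp (lam : YoungDiagram) : coversUp lam = rimHooksUp 1 lam := by
  ext gam
  simp [coversUp, rimHooksUp, covers_iff_isRimHook]

theorem height_eq_zero_of_isRimHook_one {gam mu : YoungDiagram} (h : IsRimHook 1 gam mu) :
    height gam mu = 0 := by
  obtain ⟨p, q, hs⟩ := h.exists_isRibbonShape
  rw [hs.height_eq le_rfl, hs.eq_of_one, Nat.sub_self]

end Appell

end WronskianAppell

end

/-! ### The top-down relations. -/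

open Polynomial WronskianAppell
theorem theorem6p2 (A : ℕ → ℝ[X]) (hA : IsAppell A) (lam : YoungDiagram) :
    ((lam.card : ℝ[X]) + 1) * (X + C (cumulant A 1)) * (numTableaux lam : ℝ[X]) * wap A lam =
        ∑ gam ∈ coversUp lam, (numTableaux gam : ℝ[X]) * wap A gam ∧
    ∀ k : ℕ, 2 ≤ k →
      (k : ℝ[X]) * C (cumulant A k) * ((lam.card + k).choose k : ℝ[X]) *
          (numTableaux lam : ℝ[X]) * wap A lam =
        ∑ gam ∈ rimHooksUp k lam,
          (-1) ^ height gam lam * (numTableaux gam : ℝ[X]) * wap A gam := by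
  constructor
  · have h := sum_rimHooksUp_wap hA 0 lam
    rw [← coversUp_eq_rimHooksUp, coeff_powerSumSeries_zero] at h
    have hs : ∀ gam ∈ coversUp lam, (-1) ^ height gam lam * (numTableaux gam : ℝ[X]) * wap A gam =
        (numTableaux gam : ℝ[X]) * wap A gam := by
      intro gam hg
      have hr : IsRimHook 1 gam lam := by
        rw [coversUp_eq_rimHooksUp] at hg
        simpa [rimHooksUp] using hg
      rw [height_eq_zero_of_isRimHook_one hr, pow_zero, one_mul]
    rw [Finset.sum_congr rfl hs] at h
    rw [h]
    simp
    ring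
  · intro k hk
    obtain ⟨m, rfl⟩ : ∃ m, k = m + 1 := ⟨k - 1, by omega⟩
    rw [sum_rimHooksUp_wap hA, factorial_mul_coeff_powerSumSeries (by omega)]
    ring
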